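/- Let $m,n,t$ be positive integers with $t\le mn$, and write $[N]=\{1,2,\ldots,N\}$. A set partition of $[mn]$ is $m$-divisible if every block has size divisible by $m$, and it is a $t$-partition if no block contains more than one element of $[t]$. A $t$-partition is non-crossing if there are no indices $i<j<k<l$ such that either $j\le t$ and $i,l$ belong to one block and $j,k$ belong to a different block, or $j>t$ and $i,k$ belong to one block and $j,l$ belong to a different block. Let $\mathbf{NC}_{n,t}^{(m)}$ be the set of all $m$-divisible non-crossing $t$-partitions of $[mn]$; the rank of such a partition is $n$ minus its number of blocks. Binomial coefficients $\binom{N}{k}$ with $k<0$ or $k>N\geq 0$ are $0$. Then the following hold. (1) Let $b_1,\ldots,b_n$ be non-negative integers and $b=b_1+b_2+\cdots+b_n$. If $b_1+2b_2+\cdots+nb_n=n$, then the number of elements of $\mathbf{NC}_{n,t}^{(m)}$ with exactly $b_i$ blocks of size $mi$, for all $i\in[n]$, equals $$\frac{(mn-t+1)\,b-mn\,(b-t)}{(mn-t+1)\,b}\binom{mn-t+1}{b-t}\binom{b}{b_1,b_2,\ldots,b_n}.$$ If $b_1+2b_2+\cdots+nb_n\neq n$, there are no such elements. (2) For every non-negative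 integer $s$, the number of elements of $\mathbf{NC}_{n,t}^{(m)}$ of rank $s$ equals $$\frac{mnt-(n-s)(t-1)}{n(mn-t+1)}\binom{mn-t+1}{n-s-t}\binom{n}{s}.$$ (3) The total number of elements of $\mathbf{NC}_{n,t}^{(m)}$ is $$\frac{mt+1}{mn+1}\binom{(m+1)n-t}{n-t}.$$ -/

import Mathlib

namespace TNoncrossing

/-- `π` is `m`-divisible: every block has size divisible by `m`. -/
def IsDivisible (m : ℕ) {N : ℕ} (π : Finpartition (Finset.Icc 1 N)) : Prop :=
  ∀ B ∈ π.parts, m ∣ B.card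

/-- `π` is a `t`-partition: no block meets `{1, …, t}` in more than one element. -/
def IsTPartition (t : ℕ) {N : ℕ} (π : Finpartition (Finset.Icc 1 N)) : Prop :=
  ∀ B ∈ π.parts, (B ∩ Finset.Icc 1 t).card ≤ 1

/-- The non-crossing condition for `t`-partitions: there are no `i < j < k < l` such that either
`j ≤ t` and `i, l` lie in one block and `j, k` in a different one, or `t < j` and `i, k` lie in one
block and `j, l` in a different one. -/
def IsNoncrossing (t : ℕ) {N : ℕ} (π : Finpartition (Finset.Icc 1 N)) : Prop :=
  ¬ ∃ i j k l : ℕ, i < j ∧ j < k ∧ k < l ∧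
    ∃ A ∈ π.parts, ∃ B ∈ π.parts, A ≠ B ∧
      ((j ≤ t ∧ i ∈ A ∧ l ∈ A ∧ j ∈ B ∧ k ∈ B) ∨
       (t < j ∧ i ∈ A ∧ k ∈ A ∧ j ∈ B ∧ l ∈ B))

/-- The set of all `m`-divisible non-crossing `t`-partitions of `{1, …, m * n}`. -/
def NC (m n t : ℕ) : Set (Finpartition (Finset.Icc 1 (m * n))) :=
  {π | IsDivisible m π ∧ IsTPartition t π ∧ IsNoncrossing t π}

/-- The number of blocks of `π` of size `k`. -/
def blocksOfSize {N : ℕ} (π : Finpartition (Finset.Icc 1 N)) (k : ℕ) : ℕ :=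
  (π.parts.filter (fun B => B.card = k)).card

/-- The rank of an `m`-divisible partition of `{1, …, m * n}`: `n` minus the number of blocks. -/
def rk {m n : ℕ} (π : Finpartition (Finset.Icc 1 (m * n))) : ℤ :=
  (n : ℤ) - (π.parts.card : ℤ)

/-- The binomial coefficient with natural upper and integer lower index; it is `0` when the lower
index is negative. -/
def binom (N : ℕ) (k : ℤ) : ℕ :=
  if 0 ≤ k then N.choose k.toNat else 0

end TNoncrossing

/-!
Reversing the order on `{1, …, t}` turns the non-crossing `t`-partitions into the ordinary
non-crossing partitions in which the points `1, …, t` all are minima of their blocks. Record the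
size of each block at its minimum and `0` at the remaining points. A non-crossing partition can be
recovered from this word, because the block with the last minimum consists of consecutive points and
can be split off; thus the partitions correspond to the ballot words without zeros among their first
`t` letters. Removing the first letter of a word yields a recursion that determines their number for
given block sizes. The sum over the types with `b` blocks is read off the generating function
`(X / (1 - X)) ^ b`, and the sum over `b` is Vandermonde's convolution.
-/

namespace TNoncrossing

section CountPerms

variable {α : Type*} [DecidableEq α]

theorem countPerms_erase_mul_card {C : Multiset α} {a : α} (ha : a ∈ C) :
    (C.erase a).countPerms * C.card = C.count a * C.countPerms := by
  obtain ⟨D, rfl⟩ := Multiset.exists_cons_of_mem ha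
  have hfilter : (a ::ₘ D).filter (a ≠ ·) = D.filter (a ≠ ·) :=
    Multiset.filter_cons_of_neg _ (not_not_intro rfl)
  rw [Multiset.countPerms_filter_ne a (a ::ₘ D), hfilter, Multiset.erase_cons_head,
    Multiset.countPerms_filter_ne a D, Multiset.count_cons_self, Multiset.card_cons]
  linear_combination (D.filter (a ≠ ·)).countPerms * Nat.add_one_mul_choose_eq D.card (D.count a)

theorem sum_countPerms_erase_mul (C : Multiset α) (g : α → ℚ) :
    (∑ a ∈ C.toFinset, (C.erase a).countPerms * g a) * C.card =
      C.countPerms * (C.map g).sum := by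
  rw [Finset.sum_multiset_map_count, Finset.sum_mul, Finset.mul_sum]
  refine Finset.sum_congr rfl fun a ha => ?_
  have herase : ((C.erase a).countPerms * C.card : ℚ) = C.count a * C.countPerms :=
    mod_cast countPerms_erase_mul_card (Multiset.mem_toFinset.1 ha)
  rw [nsmul_eq_mul]
  linear_combination g a * herase

theorem countPerms_add_replicate {C : Multiset α} {a : α} (ha : a ∉ C) (z : ℕ) :
    (C + Multiset.replicate z a).countPerms = (C.card + z).choose z * C.countPerms := by
  have hfilter : (C + Multiset.replicate z a).filter (a ≠ ·) = C := by
    rw [Multiset.filter_add,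
      Multiset.filter_eq_self.2 fun b hb => (ne_of_mem_of_not_mem hb ha).symm,
      Multiset.filter_eq_nil.2 fun b hb => not_not_intro (Multiset.eq_of_mem_replicate hb).symm,
      add_zero]
  rw [Multiset.countPerms_filter_ne a, hfilter]
  simp [ha]

end CountPerms

theorem card_le_sum_of_zero_notMem {M : Multiset ℕ} (hM : 0 ∉ M) : M.card ≤ M.sum := by
  simpa using Multiset.card_nsmul_le_sum (a := 1) fun a ha =>
    Nat.one_le_iff_ne_zero.2 (ne_of_mem_of_not_mem ha hM)

theorem sum_map_affine {R : Type*} [CommSemiring R] (C : Multiset ℕ) (p q : R) :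
    (C.map fun a : ℕ => p + q * a).sum = C.card * p + q * (C.sum : ℕ) := by
  simp [Multiset.sum_map_add, Multiset.sum_map_mul_left]

theorem sum_countPerms_erase_mul_affine {C : Multiset ℕ} (hC : C ≠ 0) (p q : ℚ) :
    ∑ a ∈ C.toFinset, (C.erase a).countPerms * (p + q * a) =
      C.countPerms * (p + q * C.sum / C.card) := by
  have hcard : (C.card : ℚ) ≠ 0 := Nat.cast_ne_zero.2 (Multiset.card_pos.2 hC).ne'
  refine mul_right_cancel₀ hcard ?_
  rw [sum_countPerms_erase_mul, sum_map_affine]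
  field_simp

/-- A word `w` describes the lattice path that starts at height `h` and whose step for the letter
`a` changes the height by `a - 1`. The path has to stay non-negative and to end at height `0`. -/
def IsBallot : ℕ → List ℕ → Prop
  | h, [] => h = 0
  | h, a :: w => 0 < h + a ∧ IsBallot (h + a - 1) w

theorem isBallot_iff (h : ℕ) (w : List ℕ) :
    IsBallot h w ↔ h + w.sum = w.length ∧ ∀ k ≤ w.length, k ≤ h + (w.take k).sum := by
  induction w generalizing h with
  | nil => simp [IsBallot]
  | cons a w ih =>
    rw [IsBallot, ih]
    simp only [List.sum_cons, List.length_cons]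
    constructor
    · rintro ⟨hpos, hsum, hpre⟩
      refine ⟨by omega, fun k hk => ?_⟩
      cases k with
      | zero => exact Nat.zero_le _
      | succ k =>
        have := hpre k (by omega)
        rw [List.take_succ_cons, List.sum_cons]
        omega
    · rintro ⟨hsum, hpre⟩
      have hpos : 1 ≤ h + a := by
        simpa only [List.take_succ_cons, List.take_zero, List.sum_singleton] using hpre 1 (by omega)
      refine ⟨hpos, by omega, fun k hk => ?_⟩
      have := hpre (k + 1) (by omega)
      rw [List.take_succ_cons, List.sum_cons] at this
      omega

/-- The ballot words from height `h` that are arrangements of the multiset `M` and whose first `t`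
letters are non-zero. -/
def ballotWords (t h : ℕ) (M : Multiset ℕ) : Set (List ℕ) :=
  {w | (w : Multiset ℕ) = M ∧ IsBallot h w ∧ ∀ a ∈ w.take t, a ≠ 0}

theorem finite_ballotWords (t h : ℕ) (M : Multiset ℕ) : (ballotWords t h M).Finite := by
  refine (List.finite_toSet M.toList.permutations).subset fun w hw => ?_
  rw [Set.mem_ofPred_eq, List.mem_permutations, ← Multiset.coe_eq_coe, Multiset.coe_toList]
  exact hw.1

theorem cons_mem_ballotWords {t h a : ℕ} {M : Multiset ℕ} {w : List ℕ} :
    a :: w ∈ ballotWords t h M ↔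
      (a ∈ M ∧ 0 < h + a ∧ (t ≠ 0 → a ≠ 0)) ∧
        w ∈ ballotWords (t - 1) (h + a - 1) (M.erase a) := by
  have hM : ((a :: w : List ℕ) : Multiset ℕ) = M ↔ a ∈ M ∧ (w : Multiset ℕ) = M.erase a := by
    rw [← Multiset.cons_coe]
    constructor
    · rintro rfl
      simp
    · rintro ⟨ha, hw⟩
      rw [hw, Multiset.cons_erase ha]
  have ht : (∀ b ∈ (a :: w).take t, b ≠ 0) ↔ (t ≠ 0 → a ≠ 0) ∧ ∀ b ∈ w.take (t - 1), b ≠ 0 := by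
    cases t <;> simp
  simp only [ballotWords, Set.mem_ofPred_eq, IsBallot, hM, ht]
  tauto

theorem ncard_ballotWords_eq_sum (t h : ℕ) {M : Multiset ℕ} (hM : M ≠ 0) :
    (ballotWords t h M).ncard =
      ∑ a ∈ M.toFinset with 0 < h + a ∧ (t ≠ 0 → a ≠ 0),
        (ballotWords (t - 1) (h + a - 1) (M.erase a)).ncard := by
  set s := M.toFinset.filter fun a => 0 < h + a ∧ (t ≠ 0 → a ≠ 0)
  have hunion : ballotWords t h M =
      ⋃ a ∈ (s : Set ℕ), List.cons a '' ballotWords (t - 1) (h + a - 1) (M.erase a) := by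
    ext w
    cases w with
    | nil => simp [ballotWords, hM.symm]
    | cons a w => simp [cons_mem_ballotWords, s, and_comm]
  have hdisj : (s : Set ℕ).PairwiseDisjoint
      fun a => List.cons a '' ballotWords (t - 1) (h + a - 1) (M.erase a) := by
    intro a _ b _ hab
    rw [Function.onFun, Set.disjoint_left]
    rintro _ ⟨u, -, rfl⟩ ⟨v, -, huv⟩
    exact hab (List.cons.inj huv).1.symm
  rw [hunion, Set.Finite.ncard_biUnion s.finite_toSet
    (fun _ _ => (finite_ballotWords _ _ _).image _) hdisj, finsum_mem_coe_finset]
  exact Finset.sum_congr rfl fun a _ => Set.ncard_image_of_injective _ List.cons_injective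

theorem ballotWords_zero (t : ℕ) : ballotWords t 0 0 = {[]} := by
  ext w
  simp +contextual [ballotWords, IsBallot]

theorem sum_count_mul_add_ite {h : ℕ} {M : Multiset ℕ} (hM : h + M.sum = M.card) :
    ∑ a ∈ M.toFinset, (M.count a * (h + a) + if a = 0 then h else 0) = M.card * (h + 1) := by
  have hmap : ∑ a ∈ M.toFinset, M.count a * (h + a) = M.card * h + M.sum := by
    have haffine := sum_map_affine M h 1
    rw [Finset.sum_multiset_map_count] at haffine
    simpa only [Nat.cast_id, smul_eq_mul, one_mul] using haffine
  have hzero : (∑ a ∈ M.toFinset, if a = 0 then h else 0) = h := by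
    rw [Finset.sum_ite_eq']
    refine ite_eq_left_iff.2 fun h0 => ?_
    have := card_le_sum_of_zero_notMem (Multiset.mem_toFinset.not.1 h0)
    omega
  rw [Finset.sum_add_distrib, hmap, hzero]
  linear_combination hM

theorem mul_count_zero_add_one_mul_card_of_erase {h x a : ℕ} {M : Multiset ℕ} (ha : a ∈ M)
    (hx : x * ((M.erase a).count 0 + 1) = (h + a) * (M.erase a).countPerms) :
    x * (M.count 0 + 1) * M.card =
      M.countPerms * (M.count a * (h + a) + if a = 0 then h else 0) := by
  have herase := countPerms_erase_mul_card ha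
  rcases eq_or_ne a 0 with rfl | ha0
  · have hpos : 0 < M.count 0 := Multiset.count_pos.2 ha
    rw [Multiset.count_erase_self, Nat.sub_add_cancel hpos] at hx
    refine Nat.eq_of_mul_eq_mul_right hpos ?_
    rw [if_pos rfl]
    linear_combination (M.count 0 + 1) * M.card * hx + (M.count 0 + 1) * h * herase
  · rw [Multiset.count_erase_of_ne ha0.symm] at hx
    rw [if_neg ha0]
    linear_combination M.card * hx + (h + a) * herase

theorem ncard_ballotWords_mul_count_zero_add_one {h : ℕ} {M : Multiset ℕ}
    (hM : h + M.sum = M.card) :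
    (ballotWords 0 h M).ncard * (M.count 0 + 1) = (h + 1) * M.countPerms := by
  induction hn : M.card generalizing h M with
  | zero =>
    obtain rfl := Multiset.card_eq_zero.1 hn
    obtain rfl : h = 0 := by simpa using hM
    simp [ballotWords_zero]
  | succ n ih =>
    have hM0 : M ≠ 0 := by
      rintro rfl
      simp at hn
    refine Nat.eq_of_mul_eq_mul_right (Multiset.card_pos.2 hM0) ?_
    rw [ncard_ballotWords_eq_sum 0 h hM0, Finset.sum_mul, Finset.sum_mul]
    calc _ = ∑ a ∈ M.toFinset with 0 < h + a ∧ (0 ≠ 0 → a ≠ 0),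
          M.countPerms * (M.count a * (h + a) + if a = 0 then h else 0) := by
          refine Finset.sum_congr rfl fun a ha => ?_
          obtain ⟨ha, hpos, -⟩ := by simpa only [Finset.mem_filter, Multiset.mem_toFinset] using ha
          have hcard := Multiset.card_erase_add_one ha
          have hsum := Multiset.sum_erase ha
          have hrec := ih (h := h + a - 1) (M := M.erase a) (by omega) (by omega)
          rw [Nat.sub_add_cancel hpos] at hrec
          exact mul_count_zero_add_one_mul_card_of_erase ha hrec
      _ = ∑ a ∈ M.toFinset, M.countPerms * (M.count a * (h + a) + if a = 0 then h else 0) := by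
          refine Finset.sum_filter_of_ne fun a _ hne => ⟨?_, fun h => absurd rfl h⟩
          contrapose! hne
          obtain ⟨rfl, rfl⟩ : h = 0 ∧ a = 0 := by omega
          simp
      _ = _ := by
          rw [← Finset.mul_sum, sum_count_mul_add_ite hM]
          ring

theorem ncard_ballotWords_zero_mul {h z : ℕ} {C : Multiset ℕ} (hC : 0 ∉ C)
    (hsum : h + C.sum = C.card + z) :
    (ballotWords 0 h (C + Multiset.replicate z 0)).ncard * (z + 1) =
      (C.card + z).choose z * C.countPerms * (h + 1) := by
  have hcount := ncard_ballotWords_mul_count_zero_add_one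
    (h := h) (M := C + Multiset.replicate z 0) (by simpa using hsum)
  rw [countPerms_add_replicate hC, Multiset.count_add, Multiset.count_eq_zero.2 hC,
    Multiset.count_replicate_self, zero_add] at hcount
  rw [hcount, mul_comm]

theorem ncard_ballotWords_succ (t h z : ℕ) {C : Multiset ℕ} (hC : 0 ∉ C)
    (hM : C + Multiset.replicate z 0 ≠ 0) :
    (ballotWords (t + 1) h (C + Multiset.replicate z 0)).ncard =
      ∑ a ∈ C.toFinset, (ballotWords t (h + a - 1) (C.erase a + Multiset.replicate z 0)).ncard := by
  have hletters : (C + Multiset.replicate z 0).toFinset.filter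
      (fun a => 0 < h + a ∧ (t + 1 ≠ 0 → a ≠ 0)) = C.toFinset := by
    ext a
    simp only [Finset.mem_filter, Multiset.mem_toFinset, Multiset.mem_add, Multiset.mem_replicate]
    have : a ∈ C → a ≠ 0 := fun ha => ne_of_mem_of_not_mem ha hC
    grind
  rw [ncard_ballotWords_eq_sum _ _ hM, hletters]
  exact Finset.sum_congr rfl fun a ha => by
    rw [Nat.add_sub_cancel, Multiset.erase_add_left_pos _ (Multiset.mem_toFinset.1 ha)]

theorem ncard_ballotWords_mul (t : ℕ) {h z : ℕ} {C : Multiset ℕ} (hC : 0 ∉ C)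
    (hsum : h + C.sum = C.card + z) (ht : t ≤ C.card + z) :
    ((ballotWords t h (C + Multiset.replicate z 0)).ncard * (z + 1) : ℚ) =
      (C.card + z - t).choose z * C.countPerms * (h + 1 - t + t * C.sum / C.card) := by
  induction t generalizing h C with
  | zero =>
    have hzero := congrArg (Nat.cast (R := ℚ)) (ncard_ballotWords_zero_mul hC hsum)
    push_cast at hzero
    simpa using hzero
  | succ t ih =>
    -- The induction hypothesis is affine in the first letter, so only its mean value matters.
    have hletter (a : ℕ) (ha : a ∈ C) :
        ((ballotWords t (h + a - 1) (C.erase a + Multiset.replicate z 0)).ncard * (z + 1) : ℚ) =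
          (C.card + z - (t + 1)).choose z * ((C.erase a).countPerms *
            (h - t + t * C.sum / (C.card - 1) + (1 - t / (C.card - 1)) * a)) := by
      have ha0 : 0 < a := Nat.pos_of_ne_zero (ne_of_mem_of_not_mem ha hC)
      have hcard := Multiset.card_erase_add_one ha
      have hsum := Multiset.sum_erase ha
      rw [ih (h := h + a - 1) (fun h0 => hC (Multiset.mem_of_mem_erase h0)) (by omega) (by omega),
        ← hcard, ← hsum, Nat.add_right_comm _ 1 z, Nat.add_sub_add_right, Nat.cast_sub (by omega)]
      push_cast
      ring
    have hM : C + Multiset.replicate z 0 ≠ 0 := by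
      rw [← Multiset.card_pos, Multiset.card_add, Multiset.card_replicate]
      omega
    rw [ncard_ballotWords_succ t h z hC hM, Nat.cast_sum, Finset.sum_mul,
      Finset.sum_congr rfl fun a ha => hletter a (Multiset.mem_toFinset.1 ha), ← Finset.mul_sum]
    rcases eq_or_ne C 0 with rfl | h0
    · rw [Multiset.card_zero] at ht
      simp [Nat.choose_eq_zero_of_lt, show z - (t + 1) < z by omega]
    rw [sum_countPerms_erase_mul_affine h0]
    have hcard : (C.card : ℚ) ≠ 0 := Nat.cast_ne_zero.2 (Multiset.card_pos.2 h0).ne'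
    rcases eq_or_ne C.card 1 with h1 | h1
    · rcases Nat.eq_zero_or_pos t with rfl | ht0
      · simp [h1]
      · simp [Nat.choose_eq_zero_of_lt, show C.card + z - (t + 1) < z by omega]
    · have h1Q : (C.card : ℚ) - 1 ≠ 0 := sub_ne_zero.2 (mod_cast h1)
      push_cast
      field_simp
      ring


section OrderedBlocks

variable {α ι : Type*} [LinearOrder ι] (e : α → ι)

/-- Two distinct blocks of `P` never cross when the points are ordered by `e`. -/
def IsNoncrossingBy (P : Finset (Finset α)) : Prop :=
  ∀ A ∈ P, ∀ B ∈ P, A ≠ B → ∀ i ∈ A, ∀ j ∈ B, ∀ k ∈ A, ∀ l ∈ B,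
    e i < e j → e j < e k → ¬ e k < e l

/-- `I` is an initial segment of `T` when the points are ordered by `e`. -/
def IsInitial (I T : Finset α) : Prop :=
  I ⊆ T ∧ ∀ x ∈ I, ∀ y ∈ T, y ∉ I → e x < e y

/-- The values of `f`, read along `S` in the order given by `e`, form a ballot sequence. -/
def IsBallotOn (S : Finset α) (f : α → ℕ) : Prop :=
  ∑ x ∈ S, f x = S.card ∧ ∀ q ∈ S, {x ∈ S | e x < e q}.card ≤ ∑ x ∈ S with e x < e q, f x

variable {e}

theorem IsNoncrossingBy.mono {P Q : Finset (Finset α)} (hQ : IsNoncrossingBy e Q) (hPQ : P ⊆ Q) :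
    IsNoncrossingBy e P :=
  fun A hA B hB => hQ A (hPQ hA) B (hPQ hB)

theorem IsInitial.subset_or_subset {I J T : Finset α} (hI : IsInitial e I T)
    (hJ : IsInitial e J T) : I ⊆ J ∨ J ⊆ I := by
  by_contra! h
  obtain ⟨x, hx, hxJ⟩ := Finset.not_subset.1 h.1
  obtain ⟨y, hy, hyI⟩ := Finset.not_subset.1 h.2
  exact lt_asymm (hI.2 x hx y (hJ.1 hy) hyI) (hJ.2 y hy x (hI.1 hx) hxJ)

theorem IsInitial.eq_of_card_eq {I J T : Finset α} (hI : IsInitial e I T)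
    (hJ : IsInitial e J T) (hcard : I.card = J.card) : I = J :=
  (hI.subset_or_subset hJ).elim (fun h => Finset.eq_of_subset_of_card_le h hcard.ge)
    fun h => (Finset.eq_of_subset_of_card_le h hcard.le).symm

theorem exists_last_ne_zero {S : Finset α} {f : α → ℕ} (hf : ∑ x ∈ S, f x ≠ 0) :
    ∃ p ∈ S, f p ≠ 0 ∧ ∀ x ∈ S, e p < e x → f x = 0 := by
  obtain ⟨q, hq, hfq⟩ := Finset.exists_ne_zero_of_sum_ne_zero hf
  obtain ⟨p, hp, hmax⟩ :=
    Finset.exists_max_image {x ∈ S | f x ≠ 0} e ⟨q, Finset.mem_filter.2 ⟨hq, hfq⟩⟩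
  rw [Finset.mem_filter] at hp
  exact ⟨p, hp.1, hp.2, fun x hx hlt => by_contra fun hfx =>
    (hmax x (Finset.mem_filter.2 ⟨hx, hfx⟩)).not_gt hlt⟩

theorem exists_isInitial (he : Function.Injective e) {T : Finset α} {s : ℕ} (hs : s ≤ T.card) :
    ∃ I, IsInitial e I T ∧ I.card = s := by
  classical
  induction s with
  | zero => exact ⟨∅, ⟨T.empty_subset, by simp⟩, rfl⟩
  | succ s ih =>
    obtain ⟨I, hI, rfl⟩ := ih (by omega)
    have hne : (T \ I).Nonempty := by
      rw [← Finset.card_pos, Finset.card_sdiff_of_subset hI.1]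
      omega
    obtain ⟨z, hz, hzmin⟩ := (T \ I).exists_min_image e hne
    rw [Finset.mem_sdiff] at hz
    refine ⟨insert z I, ⟨Finset.insert_subset hz.1 hI.1, fun x hx y hy hyI => ?_⟩,
      Finset.card_insert_of_notMem hz.2⟩
    rw [Finset.mem_insert, not_or] at hyI
    rcases Finset.mem_insert.1 hx with rfl | hx
    · exact (hzmin y (Finset.mem_sdiff.2 ⟨hy, hyI.2⟩)).lt_of_ne fun h => hyI.1 (he h).symm
    · exact hI.2 x hx y hy hyI.2

theorem IsInitial.mem_of_nonempty {I S : Finset α} {p : α} (hp : p ∈ S)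
    (hI : IsInitial e I {x ∈ S | e p ≤ e x}) (hne : I.Nonempty) : p ∈ I := by
  obtain ⟨x, hx⟩ := hne
  by_contra hpI
  exact (hI.2 x hx p (Finset.mem_filter.2 ⟨hp, le_rfl⟩) hpI).not_ge
    (Finset.mem_filter.1 (hI.1 hx)).2

theorem IsBallotOn.le_card_filter {S : Finset α} {f : α → ℕ} (hf : IsBallotOn e S f) {p : α}
    (hp : p ∈ S) : f p ≤ {x ∈ S | e p ≤ e x}.card := by
  have hcard := Finset.card_filter_add_card_filter_not (s := S) (e · < e p)
  have hsum := Finset.sum_filter_add_sum_filter_not S (e · < e p) f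
  simp only [not_lt] at hcard hsum
  have hsingle : f p ≤ ∑ x ∈ S with e p ≤ e x, f x :=
    Finset.single_le_sum (fun _ _ => Nat.zero_le _) (Finset.mem_filter.2 ⟨hp, le_rfl⟩)
  have hprefix := hf.2 p hp
  have htotal := hf.1
  omega

variable [DecidableEq α] {S T : Finset α}

theorem IsBallotOn.sdiff (he : Function.Injective e) {f : α → ℕ} (hf : IsBallotOn e S f) {p : α}
    (hlast : ∀ x ∈ S, e p < e x → f x = 0) {I : Finset α}
    (hI : IsInitial e I {x ∈ S | e p ≤ e x}) (hpI : p ∈ I) (hcard : I.card = f p) :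
    IsBallotOn e (S \ I) f := by
  have hIS : I ⊆ S := hI.1.trans (Finset.filter_subset _ _)
  have hle (x : α) (hx : x ∈ I) : e p ≤ e x := (Finset.mem_filter.1 (hI.1 hx)).2
  have htotal : ∑ x ∈ S \ I, f x = (S \ I).card := by
    have hsumI : ∑ x ∈ I, f x = f p := Finset.sum_eq_single_of_mem p hpI fun x hx hxp =>
      hlast x (hIS hx) ((hle x hx).lt_of_ne fun h => hxp (he h).symm)
    have hsum := Finset.sum_sdiff (f := f) hIS
    have htotalS := hf.1
    rw [Finset.card_sdiff_of_subset hIS]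
    omega
  refine ⟨htotal, fun q hq => ?_⟩
  rcases le_or_gt (e q) (e p) with hqp | hqp
  · have hfilter : {x ∈ S \ I | e x < e q} = {x ∈ S | e x < e q} := by
      refine (Finset.filter_subset_filter _ Finset.sdiff_subset).antisymm fun x hx => ?_
      rw [Finset.mem_filter] at hx
      exact Finset.mem_filter.2 ⟨Finset.mem_sdiff.2
        ⟨hx.1, fun hxI => (hx.2.trans_le (hqp.trans (hle x hxI))).false⟩, hx.2⟩
    rw [hfilter]
    exact hf.2 q (Finset.sdiff_subset hq)
  · calc {x ∈ S \ I | e x < e q}.card ≤ (S \ I).card := Finset.card_filter_le _ _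
      _ = ∑ x ∈ S \ I with e x < e q, f x := by
        rw [← htotal, Finset.sum_filter_of_ne]
        intro x hx hfx
        by_contra hxq
        exact hfx (hlast x (Finset.sdiff_subset hx) (hqp.trans_le (not_lt.1 hxq)))

theorem IsNoncrossingBy.insert {P : Finset (Finset α)} (hP : IsNoncrossingBy e P) {p : α}
    {I : Finset α} (hI : IsInitial e I {x ∈ S | e p ≤ e x}) (hPI : ∀ A ∈ P, A ⊆ S \ I) :
    IsNoncrossingBy e (insert I P) := by
  have hlt (x : α) (hx : x ∈ I) {A : Finset α} (hA : A ∈ P) (y : α) (hy : y ∈ A)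
      (hpy : e p ≤ e y) : e x < e y := by
    have hyS := Finset.mem_sdiff.1 (hPI A hA hy)
    exact hI.2 x hx y (Finset.mem_filter.2 ⟨hyS.1, hpy⟩) hyS.2
  have hle (x : α) (hx : x ∈ I) : e p ≤ e x := (Finset.mem_filter.1 (hI.1 hx)).2
  intro A hA B hB hAB i hi j hj k hk l hl hij hjk hkl
  rcases Finset.mem_insert.1 hA with rfl | hAP <;> rcases Finset.mem_insert.1 hB with rfl | hBP
  · exact hAB rfl
  · exact (hlt k hk hBP j hj ((hle i hi).trans hij.le)).not_gt hjk
  · exact (hlt l hl hAP k hk ((hle j hj).trans hjk.le)).not_gt hkl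
  · exact hP A hAP B hBP hAB i hi j hj k hk l hl hij hjk hkl

variable (e)

/-- The points of `S` that come first in their block when the points are ordered by `e`. -/
def openers (π : Finpartition S) : Finset α :=
  {x ∈ S | ∀ y ∈ π.part x, e x ≤ e y}

/-- The size of the block opened by the point `x`, and `0` if `x` does not open a block. -/
def openSize (π : Finpartition S) (x : α) : ℕ :=
  if x ∈ openers e π then (π.part x).card else 0

variable {e}

theorem openSize_ne_zero {π : Finpartition S} {x : α} : openSize e π x ≠ 0 ↔ x ∈ openers e π := by
  rw [openSize, ite_ne_right_iff, and_iff_left_iff_imp, Finset.card_ne_zero, π.part_nonempty]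
  exact fun hx => (Finset.mem_filter.1 hx).1

theorem openSize_eq_ite (he : Function.Injective e) {π : Finpartition S} {B : Finset α}
    (hB : B ∈ π.parts) {p x : α} (hp : p ∈ B) (hmin : ∀ y ∈ B, e p ≤ e y) (hx : x ∈ B) :
    openSize e π x = if x = p then B.card else 0 := by
  have hpart := π.part_eq_of_mem hB hx
  have hopen : x ∈ openers e π ↔ x = p := by
    rw [openers, Finset.mem_filter, hpart, and_iff_right (π.subset hB hx)]
    exact ⟨fun h => he ((h p hp).antisymm (hmin x hx)), fun h => h ▸ hmin⟩
  simp only [openSize, hopen, hpart]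

theorem exists_mem_openers (π : Finpartition S) {x : α} (hx : x ∈ S) :
    ∃ q ∈ openers e π, π.part q = π.part x ∧ e q ≤ e x := by
  obtain ⟨q, hq, hmin⟩ := (π.part x).exists_min_image e (π.part_nonempty.2 hx)
  have hpart : π.part q = π.part x := π.part_eq_of_mem (π.part_mem.2 hx) hq
  exact ⟨q, Finset.mem_filter.2 ⟨π.part_subset x hq, hpart ▸ hmin⟩, hpart,
    hmin x (π.mem_part_self.2 hx)⟩

theorem bijOn_part_openers (he : Function.Injective e) (π : Finpartition S) :
    Set.BijOn π.part (openers e π) π.parts := by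
  refine ⟨fun x hx => π.part_mem.2 (Finset.mem_filter.1 hx).1, fun x hx y hy hxy => ?_,
    fun B hB => ?_⟩
  · have hx := Finset.mem_filter.1 hx
    have hy := Finset.mem_filter.1 hy
    exact he (le_antisymm (hx.2 y (hxy ▸ π.mem_part_self.2 hy.1))
      (hy.2 x (hxy ▸ π.mem_part_self.2 hx.1)))
  · obtain ⟨x, hx⟩ := π.nonempty_of_mem_parts hB
    obtain ⟨q, hq, hpart, -⟩ := exists_mem_openers (e := e) π (π.subset hB hx)
    exact ⟨q, hq, hpart.trans (π.part_eq_of_mem hB hx)⟩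

/-- The multiset of the block sizes of `π`. -/
def blockCards (π : Finpartition S) : Multiset ℕ :=
  π.parts.val.map Finset.card

theorem map_openSize_val (he : Function.Injective e) (π : Finpartition S) :
    S.val.map (openSize e π) =
      blockCards π + Multiset.replicate (S.card - π.parts.card) 0 := by
  have hbij := bijOn_part_openers he π
  have hparts : π.parts.val = (openers e π).val.map π.part := by
    rw [← Finset.image_val_of_injOn hbij.injOn]
    congr 1
    exact_mod_cast hbij.image_eq.symm
  have hsub : openers e π ⊆ S := Finset.filter_subset _ _
  have hcard : π.parts.card = (openers e π).card := by
    rw [Finset.card_def, hparts, Multiset.card_map, Finset.card_def]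
  have hopen : (openers e π).val.map (openSize e π) = blockCards π := by
    rw [blockCards, hparts, Multiset.map_map]
    exact Multiset.map_congr rfl fun x hx => if_pos hx
  have hrest : (S \ openers e π).val.map (openSize e π) =
      Multiset.replicate (S.card - π.parts.card) 0 := by
    rw [hcard, ← Finset.card_sdiff_of_subset hsub, Finset.card_def, ← Multiset.map_const']
    exact Multiset.map_congr rfl fun x hx => if_neg (Finset.mem_sdiff.1 hx).2
  rw [← hopen, ← hrest, ← Multiset.map_add, Finset.sdiff_val,
    add_tsub_cancel_of_le (Finset.val_le_iff.2 hsub)]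

theorem isBallotOn_openSize (he : Function.Injective e) (π : Finpartition S) :
    IsBallotOn e S (openSize e π) := by
  constructor
  · have hsum := congrArg Multiset.sum (map_openSize_val he π)
    rw [Multiset.sum_add, Multiset.sum_replicate, smul_zero, add_zero] at hsum
    exact hsum.trans π.sum_card_parts
  · intro p _
    have hcover : {x ∈ S | e x < e p} ⊆ {x ∈ openers e π | e x < e p}.biUnion π.part := by
      intro x hx
      rw [Finset.mem_filter] at hx
      obtain ⟨q, hq, hpart, hle⟩ := exists_mem_openers (e := e) π hx.1
      exact Finset.mem_biUnion.2 ⟨q, Finset.mem_filter.2 ⟨hq, hle.trans_lt hx.2⟩,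
        hpart ▸ π.mem_part_self.2 hx.1⟩
    calc {x ∈ S | e x < e p}.card ≤ ∑ x ∈ openers e π with e x < e p, (π.part x).card :=
          (Finset.card_le_card hcover).trans Finset.card_biUnion_le
      _ = ∑ x ∈ openers e π with e x < e p, openSize e π x :=
          Finset.sum_congr rfl fun x hx => (if_pos (Finset.mem_filter.1 hx).1).symm
      _ ≤ ∑ x ∈ S with e x < e p, openSize e π x := Finset.sum_le_sum_of_subset
          (Finset.filter_subset_filter _ (Finset.filter_subset _ _))

theorem openSize_eq_of_parts_subset {π : Finpartition S} {ρ : Finpartition T}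
    (h : ρ.parts ⊆ π.parts) {x : α} (hx : x ∈ T) : openSize e ρ x = openSize e π x := by
  have hpart : π.part x = ρ.part x :=
    π.part_eq_of_mem (h (ρ.part_mem.2 hx)) (ρ.mem_part_self.2 hx)
  have hxS : x ∈ S := π.part_subset x (hpart ▸ ρ.mem_part_self.2 hx)
  simp only [openSize, openers, Finset.mem_filter, hx, hxS, hpart]

theorem IsNoncrossingBy.isInitial_part (he : Function.Injective e) {π : Finpartition S}
    (hπ : IsNoncrossingBy e π.parts) {p : α} (hp : openSize e π p ≠ 0)
    (hlast : ∀ x ∈ S, e p < e x → openSize e π x = 0) :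
    IsInitial e (π.part p) {x ∈ S | e p ≤ e x} := by
  obtain ⟨hpS, hmin⟩ := Finset.mem_filter.1 (openSize_ne_zero.1 hp)
  refine ⟨fun x hx => Finset.mem_filter.2 ⟨π.part_subset p hx, hmin x hx⟩, fun x hx y hy hyp => ?_⟩
  obtain ⟨hyS, hpy⟩ := Finset.mem_filter.1 hy
  have hpp : p ∈ π.part p := π.mem_part_self.2 hpS
  obtain ⟨q, hq, hpart, -⟩ := exists_mem_openers (e := e) π hyS
  have hqmem : q ∈ π.part y := hpart ▸ π.mem_part_self.2 (Finset.mem_filter.1 hq).1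
  have hne : π.part y ≠ π.part p := fun h => hyp (h ▸ π.mem_part_self.2 hyS)
  have hqp : e q < e p := by
    refine lt_of_le_of_ne (not_lt.1 fun h => openSize_ne_zero.2 hq
      (hlast q (Finset.mem_filter.1 hq).1 h)) fun h => hne ?_
    rw [← hpart, he h]
  by_contra hyx
  refine hπ _ (π.part_mem.2 hyS) _ (π.part_mem.2 hpS) hne q hqmem p hpp y (π.mem_part_self.2 hyS)
    x hx hqp (hpy.lt_of_ne fun h => hyp (he h ▸ hpp))
    ((not_lt.1 hyx).lt_of_ne fun h => hyp (he h ▸ hx))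

theorem parts_avoid {π : Finpartition S} {B : Finset α} (hB : B ∈ π.parts) :
    (π.avoid B).parts = π.parts.erase B := by
  ext A
  simp only [Finpartition.mem_avoid, Finset.mem_erase]
  have hdisj {D : Finset α} (hD : D ∈ π.parts) (hDB : D ≠ B) : D \ B = D :=
    sdiff_eq_left.2 (π.disjoint hD hB hDB)
  constructor
  · rintro ⟨D, hD, hDB, rfl⟩
    have hne : D ≠ B := fun h => hDB h.subset
    rw [hdisj hD hne]
    exact ⟨hne, hD⟩
  · rintro ⟨hne, hA⟩
    refine ⟨A, hA, fun hAB => π.ne_empty hA ?_, hdisj hA hne⟩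
    rw [← hdisj hA hne, Finset.sdiff_eq_empty_iff_subset.2 hAB]

theorem eq_of_openSize_eqOn (he : Function.Injective e) {π ρ : Finpartition S}
    (hπ : IsNoncrossingBy e π.parts) (hρ : IsNoncrossingBy e ρ.parts)
    (h : ∀ x ∈ S, openSize e π x = openSize e ρ x) : π = ρ := by
  induction S using Finset.strongInduction with
  | H S ih =>
  rcases S.eq_empty_or_nonempty with rfl | hne
  · exact Subsingleton.elim (α := Finpartition (⊥ : Finset α)) π ρ
  obtain ⟨p, hpS, hp, hlast⟩ := exists_last_ne_zero (e := e) (f := openSize e π)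
    ((isBallotOn_openSize he π).1.trans_ne hne.card_ne_zero)
  have hIπ := hπ.isInitial_part he hp hlast
  have hIρ := hρ.isInitial_part he (h p hpS ▸ hp) fun x hx hlt => h x hx ▸ hlast x hx hlt
  have hblock : ρ.part p = π.part p := by
    refine hIρ.eq_of_card_eq hIπ ?_
    have hpπ : openSize e π p = (π.part p).card := if_pos (openSize_ne_zero.1 hp)
    have hpρ : openSize e ρ p = (ρ.part p).card := if_pos (openSize_ne_zero.1 (h p hpS ▸ hp))
    rw [← hpρ, ← hpπ, h p hpS]
  have hBπ : π.part p ∈ π.parts := π.part_mem.2 hpS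
  have hBρ : π.part p ∈ ρ.parts := hblock ▸ ρ.part_mem.2 hpS
  have hrest : π.avoid (π.part p) = ρ.avoid (π.part p) := by
    have hsubπ := (parts_avoid hBπ).trans_subset (Finset.erase_subset _ _)
    have hsubρ := (parts_avoid hBρ).trans_subset (Finset.erase_subset _ _)
    refine ih _ (Finset.sdiff_ssubset (π.part_subset p) (π.part_nonempty.2 hpS))
      (hπ.mono hsubπ) (hρ.mono hsubρ) fun x hx => ?_
    rw [openSize_eq_of_parts_subset hsubπ hx, openSize_eq_of_parts_subset hsubρ hx,
      h x (Finset.sdiff_subset hx)]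
  apply Finpartition.ext
  rw [← Finset.insert_erase hBπ, ← parts_avoid hBπ, hrest, parts_avoid hBρ,
    Finset.insert_erase hBρ]

theorem exists_isNoncrossingBy_openSize_eqOn (he : Function.Injective e) {f : α → ℕ}
    (hf : IsBallotOn e S f) :
    ∃ π : Finpartition S, IsNoncrossingBy e π.parts ∧ ∀ x ∈ S, openSize e π x = f x := by
  induction S using Finset.strongInduction with
  | H S ih =>
  rcases S.eq_empty_or_nonempty with rfl | hne
  · exact ⟨⊥, by simp [IsNoncrossingBy], by simp⟩
  obtain ⟨p, hpS, hp, hlast⟩ := exists_last_ne_zero (e := e) (hf.1.trans_ne hne.card_ne_zero)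
  obtain ⟨I, hI, hcard⟩ := exists_isInitial he (hf.le_card_filter hpS)
  have hIne : I.Nonempty := Finset.card_pos.1 (hcard ▸ Nat.pos_of_ne_zero hp)
  have hpI := hI.mem_of_nonempty hpS hIne
  have hIS : I ⊆ S := hI.1.trans (Finset.filter_subset _ _)
  obtain ⟨ρ, hρ, hρf⟩ := ih (S \ I) (Finset.sdiff_ssubset hIS hIne) (hf.sdiff he hlast hI hpI hcard)
  let π : Finpartition S := ρ.extend hIne.ne_empty Finset.sdiff_disjoint
    (Finset.sdiff_union_of_subset hIS)
  have hIπ : I ∈ π.parts := Finset.mem_insert_self I ρ.parts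
  have hρπ : ρ.parts ⊆ π.parts := Finset.subset_insert I ρ.parts
  refine ⟨π, hρ.insert hI fun A hA => ρ.subset hA, fun x hx => ?_⟩
  by_cases hxI : x ∈ I
  · have hmin (y : α) (hy : y ∈ I) : e p ≤ e y := (Finset.mem_filter.1 (hI.1 hy)).2
    rw [openSize_eq_ite he hIπ hpI hmin hxI]
    split_ifs with hxp
    · rw [hcard, hxp]
    · exact (hlast x hx ((hmin x hxI).lt_of_ne fun h => hxp (he h).symm)).symm
  · have hx' : x ∈ S \ I := Finset.mem_sdiff.2 ⟨hx, hxI⟩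
    rw [← hρf x hx', openSize_eq_of_parts_subset hρπ hx']

end OrderedBlocks

section TPartitions

/-- The involution of `ℕ` that reverses `{1, …, t}`. Comparing points by their images under it
lists the points `t, …, 1` before the points `t + 1, t + 2, …`. -/
def reverseInitial (t x : ℕ) : ℕ :=
  if 1 ≤ x ∧ x ≤ t then t + 1 - x else x

theorem reverseInitial_involutive (t : ℕ) : Function.Involutive (reverseInitial t) := by
  intro x
  unfold reverseInitial
  split_ifs <;> omega

theorem reverseInitial_injective (t : ℕ) : Function.Injective (reverseInitial t) :=
  (reverseInitial_involutive t).injective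

theorem reverseInitial_mem_Icc {t N : ℕ} (htN : t ≤ N) {x : ℕ} :
    reverseInitial t x ∈ Finset.Icc 1 N ↔ x ∈ Finset.Icc 1 N := by
  unfold reverseInitial
  simp only [Finset.mem_Icc]
  split_ifs <;> omega

theorem reverseInitial_lt_iff {t x y : ℕ} (hx : 1 ≤ x) (hy : 1 ≤ y) :
    reverseInitial t x < reverseInitial t y ↔ y < x ∧ x ≤ t ∨ t < y ∧ x < y := by
  unfold reverseInitial
  split_ifs <;> omega

theorem IsTPartition.eq_of_mem {t N : ℕ} {π : Finpartition (Finset.Icc 1 N)}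
    (h : IsTPartition t π) {B : Finset ℕ} (hB : B ∈ π.parts) {x y : ℕ} (hx : x ∈ B) (hy : y ∈ B)
    (hxt : x ≤ t) (hyt : y ≤ t) : x = y := by
  have hmem {z : ℕ} (hz : z ∈ B) (hzt : z ≤ t) : z ∈ B ∩ Finset.Icc 1 t :=
    Finset.mem_inter.2 ⟨hz, Finset.mem_Icc.2 ⟨(Finset.mem_Icc.1 (π.subset hB hz)).1, hzt⟩⟩
  exact Finset.card_le_one.1 (h B hB) x (hmem hx hxt) y (hmem hy hyt)

theorem IsTPartition.isNoncrossing_iff {t N : ℕ} {π : Finpartition (Finset.Icc 1 N)}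
    (h : IsTPartition t π) :
    IsNoncrossing t π ↔ IsNoncrossingBy (reverseInitial t) π.parts := by
  have hlt {A B : Finset ℕ} (hA : A ∈ π.parts) (hB : B ∈ π.parts) {x y : ℕ} (hx : x ∈ A)
      (hy : y ∈ B) : reverseInitial t x < reverseInitial t y ↔ y < x ∧ x ≤ t ∨ t < y ∧ x < y :=
    reverseInitial_lt_iff (Finset.mem_Icc.1 (π.subset hA hx)).1
      (Finset.mem_Icc.1 (π.subset hB hy)).1
  constructor
  · intro hπ A hA B hB hAB i hi j hj k hk l hl hij hjk hkl
    rw [hlt hA hB hi hj] at hij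
    rw [hlt hB hA hj hk] at hjk
    rw [hlt hA hB hk hl] at hkl
    have hkt : t < k := by
      by_contra hkt
      have hik := h.eq_of_mem hA hi hk (by omega) (by omega)
      omega
    rcases le_or_gt j t with hjt | hjt
    · exact hπ ⟨j, i, k, l, by omega, by omega, by omega, B, hB, A, hA, hAB.symm,
        Or.inl ⟨by omega, hj, hl, hi, hk⟩⟩
    · exact hπ ⟨i, j, k, l, by omega, by omega, by omega, A, hA, B, hB, hAB,
        Or.inr ⟨hjt, hi, hk, hj, hl⟩⟩
  · rintro hπ ⟨i, j, k, l, hij, hjk, hkl, A, hA, B, hB, hAB,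
      ⟨hjt, hi, hl, hj, hk⟩ | ⟨hjt, hi, hk, hj, hl⟩⟩
    · have hkt : t < k := by
        by_contra hkt
        exact hjk.ne (h.eq_of_mem hB hj hk hjt (by omega))
      refine hπ B hB A hA hAB.symm j hj i hi k hk l hl ((hlt hB hA hj hi).2 ?_)
        ((hlt hA hB hi hk).2 ?_) ((hlt hB hA hk hl).2 ?_) <;> omega
    · refine hπ A hA B hB hAB i hi j hj k hk l hl ((hlt hA hB hi hj).2 ?_)
        ((hlt hB hA hj hk).2 ?_) ((hlt hA hB hk hl).2 ?_) <;> omega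

theorem isTPartition_iff_openSize_ne_zero {t N : ℕ} (htN : t ≤ N)
    {π : Finpartition (Finset.Icc 1 N)} :
    IsTPartition t π ↔ ∀ x ∈ Finset.Icc 1 t, openSize (reverseInitial t) π x ≠ 0 := by
  simp only [openSize_ne_zero, openers, Finset.mem_filter]
  constructor
  · intro h x hx
    have hxN := Finset.Icc_subset_Icc_right htN hx
    rw [Finset.mem_Icc] at hx
    refine ⟨hxN, fun y hy => not_lt.1 fun hlt => hlt.ne (congrArg _ ?_)⟩
    have hy1 : 1 ≤ y := (Finset.mem_Icc.1 (π.part_subset x hy)).1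
    rw [reverseInitial_lt_iff hy1 hx.1] at hlt
    exact h.eq_of_mem (π.part_mem.2 hxN) hy (π.mem_part_self.2 hxN) (by omega) hx.2
  · intro h B hB
    refine Finset.card_le_one.2 fun x hx y hy => ?_
    rw [Finset.mem_inter] at hx hy
    have hpx := π.part_eq_of_mem hB hx.1
    have hpy := π.part_eq_of_mem hB hy.1
    exact reverseInitial_injective t
      (le_antisymm ((h x hx.2).2 y (hpx ▸ hy.1)) ((h y hy.2).2 x (hpy ▸ hx.1)))

theorem map_filter_reverseInitial_lt {t N k : ℕ} (htN : t ≤ N) (hk : k ≤ N) (f : ℕ → ℕ) :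
    {y ∈ Finset.Icc 1 N | reverseInitial t y < k + 1}.val.map f =
      ((List.range k).map fun j => f (reverseInitial t (j + 1)) : List ℕ) := by
  have hinj : Function.Injective fun j => reverseInitial t (j + 1) :=
    (reverseInitial_injective t).comp (add_left_injective 1)
  have hrange : {y ∈ Finset.Icc 1 N | reverseInitial t y < k + 1} =
      (Finset.range k).map ⟨_, hinj⟩ := by
    ext y
    simp only [Finset.mem_filter, Finset.mem_map, Finset.mem_range, Function.Embedding.coeFn_mk]
    rw [← reverseInitial_mem_Icc htN, Finset.mem_Icc]
    constructor
    · intro hy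
      refine ⟨reverseInitial t y - 1, by omega, ?_⟩
      rw [Nat.sub_add_cancel hy.1.1, reverseInitial_involutive]
    · rintro ⟨j, hj, rfl⟩
      rw [reverseInitial_involutive]
      omega
  rw [hrange, Finset.map_val, Multiset.map_map]
  rfl

theorem map_Icc_eq_map_range_reverseInitial {t N : ℕ} (htN : t ≤ N) (f : ℕ → ℕ) :
    (Finset.Icc 1 N).val.map f =
      ((List.range N).map fun j => f (reverseInitial t (j + 1)) : List ℕ) := by
  rw [← map_filter_reverseInitial_lt htN le_rfl, Finset.filter_true_of_mem]
  intro y hy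
  rw [← reverseInitial_mem_Icc htN, Finset.mem_Icc] at hy
  omega

theorem isBallot_map_range_reverseInitial_iff {t N : ℕ} (htN : t ≤ N) (f : ℕ → ℕ) :
    IsBallot 0 ((List.range N).map fun j => f (reverseInitial t (j + 1))) ↔
      IsBallotOn (reverseInitial t) (Finset.Icc 1 N) f := by
  set w := (List.range N).map fun j => f (reverseInitial t (j + 1)) with hw
  have htotal : ∑ x ∈ Finset.Icc 1 N, f x = w.sum :=
    congrArg Multiset.sum (map_Icc_eq_map_range_reverseInitial htN f)
  have hlen : w.length = N := by rw [hw, List.length_map, List.length_range]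
  have htake {k : ℕ} (hk : k ≤ N) :
      {y ∈ Finset.Icc 1 N | reverseInitial t y < k + 1}.val.map f = w.take k := by
    rw [map_filter_reverseInitial_lt htN hk, hw, ← List.map_take, List.take_range, min_eq_left hk]
  have hcard {k : ℕ} (hk : k ≤ N) :
      {y ∈ Finset.Icc 1 N | reverseInitial t y < k + 1}.card = k := by
    have h := congrArg Multiset.card (htake hk)
    rwa [Multiset.card_map, Multiset.coe_card, List.length_take, hlen, min_eq_left hk] at h
  have hsum {k : ℕ} (hk : k ≤ N) :
      ∑ y ∈ Finset.Icc 1 N with reverseInitial t y < k + 1, f y = (w.take k).sum :=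
    congrArg Multiset.sum (htake hk)
  rw [isBallot_iff, hlen, zero_add, IsBallotOn, htotal, Nat.card_Icc, Nat.add_sub_cancel]
  refine and_congr_right fun hN => ⟨fun h q hq => ?_, fun h k hk => ?_⟩
  · rw [← reverseInitial_mem_Icc htN, Finset.mem_Icc] at hq
    obtain ⟨k, hqk⟩ := Nat.exists_eq_add_of_le' hq.1
    have hkN : k ≤ N := by omega
    rw [hqk, hcard hkN, hsum hkN, ← zero_add (List.sum _)]
    exact h k hkN
  · rcases hk.eq_or_lt with rfl | hkN
    · rw [List.take_of_length_le hlen.le, hN, zero_add]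
    · have hq : reverseInitial t (k + 1) ∈ Finset.Icc 1 N := by
        rw [reverseInitial_mem_Icc htN, Finset.mem_Icc]
        omega
      have hprefix := h _ hq
      rwa [reverseInitial_involutive, hcard hk, hsum hk, ← zero_add (List.sum _)] at hprefix

/-- The sizes of the blocks opened by the points `t, …, 1, t + 1, …, N`, in this order. -/
def letters (t : ℕ) {N : ℕ} (π : Finpartition (Finset.Icc 1 N)) : List ℕ :=
  (List.range N).map fun j => openSize (reverseInitial t) π (reverseInitial t (j + 1))

theorem map_range_reverseInitial_eq_iff {t N : ℕ} (htN : t ≤ N) {f g : ℕ → ℕ} :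
    ((List.range N).map fun j => f (reverseInitial t (j + 1))) =
      ((List.range N).map fun j => g (reverseInitial t (j + 1))) ↔
      ∀ x ∈ Finset.Icc 1 N, f x = g x := by
  rw [List.map_inj_left]
  constructor
  · intro h x hx
    rw [← reverseInitial_mem_Icc htN, Finset.mem_Icc] at hx
    have hj := h (reverseInitial t x - 1) (List.mem_range.2 (by omega))
    rwa [Nat.sub_add_cancel hx.1, reverseInitial_involutive] at hj
  · intro h j hj
    refine h _ ((reverseInitial_mem_Icc htN).2 (Finset.mem_Icc.2 ?_))
    have := List.mem_range.1 hj
    omega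

theorem forall_mem_take_letters_ne_zero_iff {t N : ℕ} (htN : t ≤ N)
    {π : Finpartition (Finset.Icc 1 N)} :
    (∀ a ∈ (letters t π).take t, a ≠ 0) ↔ IsTPartition t π := by
  rw [isTPartition_iff_openSize_ne_zero htN, letters, ← List.map_take, List.take_range,
    min_eq_left htN]
  constructor
  · intro h x hx
    refine h _ ?_
    rw [← Multiset.mem_coe, ← map_Icc_eq_map_range_reverseInitial le_rfl]
    exact Multiset.mem_map_of_mem _ hx
  · intro h a ha
    rw [← Multiset.mem_coe, ← map_Icc_eq_map_range_reverseInitial le_rfl] at ha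
    obtain ⟨x, hx, rfl⟩ := Multiset.mem_map.1 ha
    exact h x hx

theorem bijOn_letters {t N : ℕ} (htN : t ≤ N) :
    Set.BijOn (letters t) {π : Finpartition (Finset.Icc 1 N) | IsTPartition t π ∧ IsNoncrossing t π}
      {w | w.length = N ∧ IsBallot 0 w ∧ ∀ a ∈ w.take t, a ≠ 0} := by
  have he := reverseInitial_injective t
  refine ⟨fun π hπ => ⟨?_, ?_, ?_⟩, fun π hπ ρ hρ h => ?_, ?_⟩
  · rw [letters, List.length_map, List.length_range]
  · exact (isBallot_map_range_reverseInitial_iff htN _).2 (isBallotOn_openSize he π)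
  · exact (forall_mem_take_letters_ne_zero_iff htN).2 hπ.1
  · exact eq_of_openSize_eqOn he (hπ.1.isNoncrossing_iff.1 hπ.2) (hρ.1.isNoncrossing_iff.1 hρ.2)
      ((map_range_reverseInitial_eq_iff htN).1 h)
  · rintro w ⟨hlen, hw, hwt⟩
    let f (x : ℕ) : ℕ := w.getD (reverseInitial t x - 1) 0
    have hf : ((List.range N).map fun j => f (reverseInitial t (j + 1))) = w := by
      refine List.ext_getElem (by simp [hlen]) fun i _ hi => ?_
      simp [f, reverseInitial_involutive t (i + 1), hi]
    rw [← hf] at hw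
    obtain ⟨π, hπ, hπf⟩ := exists_isNoncrossingBy_openSize_eqOn he
      ((isBallot_map_range_reverseInitial_iff htN f).1 hw)
    have hletters : letters t π = w := ((map_range_reverseInitial_eq_iff htN).2 hπf).trans hf
    have hT : IsTPartition t π := by
      rwa [← forall_mem_take_letters_ne_zero_iff htN, hletters]
    exact ⟨π, ⟨hT, hT.isNoncrossing_iff.2 hπ⟩, hletters⟩

theorem coe_letters {t N : ℕ} (htN : t ≤ N) (π : Finpartition (Finset.Icc 1 N)) :
    (letters t π : Multiset ℕ) = blockCards π + Multiset.replicate (N - π.parts.card) 0 := by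
  rw [letters, ← map_Icc_eq_map_range_reverseInitial htN,
    map_openSize_val (reverseInitial_injective t), Nat.card_Icc, Nat.add_sub_cancel]

theorem zero_notMem_blockCards {N : ℕ} (π : Finpartition (Finset.Icc 1 N)) : 0 ∉ blockCards π := by
  intro h
  obtain ⟨B, hB, hB0⟩ := Multiset.mem_map.1 h
  exact (π.nonempty_of_mem_parts hB).card_ne_zero hB0

theorem coe_letters_eq_iff {t N : ℕ} (htN : t ≤ N) {π : Finpartition (Finset.Icc 1 N)}
    {C : Multiset ℕ} (hC : 0 ∉ C) :
    (letters t π : Multiset ℕ) = C + Multiset.replicate (N - C.card) 0 ↔ blockCards π = C := by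
  have hfilter {D : Multiset ℕ} (hD : 0 ∉ D) (z : ℕ) :
      (D + Multiset.replicate z 0).filter (· ≠ 0) = D := by
    rw [Multiset.filter_add, Multiset.filter_eq_self.2 fun a ha => ne_of_mem_of_not_mem ha hD,
      Multiset.filter_eq_nil.2 fun a ha => not_not.2 (Multiset.eq_of_mem_replicate ha), add_zero]
  rw [coe_letters htN]
  constructor
  · intro h
    rw [← hfilter (zero_notMem_blockCards π) (N - π.parts.card), h, hfilter hC]
  · rintro rfl
    rw [blockCards, Multiset.card_map, Finset.card_def]

theorem ncard_blockCards_eq_mul {t N : ℕ} (htN : t ≤ N) {C : Multiset ℕ} (hC : 0 ∉ C)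
    (hsum : C.sum = N) :
    ({π : Finpartition (Finset.Icc 1 N) | IsTPartition t π ∧ IsNoncrossing t π ∧
        blockCards π = C}.ncard * ((N - C.card : ℕ) + 1) : ℚ) =
      (N - t).choose (N - C.card) * C.countPerms * (1 - t + t * N / C.card) := by
  have hcard : C.card + (N - C.card) = N := Nat.add_sub_of_le (hsum ▸ card_le_sum_of_zero_notMem hC)
  have hwords : ballotWords t 0 (C + Multiset.replicate (N - C.card) 0) ⊆
      {w | w.length = N ∧ IsBallot 0 w ∧ ∀ a ∈ w.take t, a ≠ 0} := by
    rintro w ⟨hw, hballot⟩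
    refine ⟨?_, hballot⟩
    rw [← Multiset.coe_card, hw, Multiset.card_add, Multiset.card_replicate, hcard]
  have hbij := (bijOn_letters htN).subset_right hwords
  have hpre : {π | IsTPartition t π ∧ IsNoncrossing t π} ∩
      letters t ⁻¹' ballotWords t 0 (C + Multiset.replicate (N - C.card) 0) =
      {π : Finpartition (Finset.Icc 1 N) | IsTPartition t π ∧ IsNoncrossing t π ∧
        blockCards π = C} := by
    ext π
    simp only [Set.mem_inter_iff, Set.mem_preimage, Set.mem_ofPred_eq, and_assoc,
      ← coe_letters_eq_iff htN hC]
    refine and_congr_right fun hT => and_congr_right fun hNC => ?_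
    have hmaps := (bijOn_letters htN).mapsTo ⟨hT, hNC⟩
    exact ⟨fun h => h.1, fun h => ⟨h, hmaps.2⟩⟩
  have hcount := ncard_ballotWords_mul t (h := 0) hC ((zero_add _).trans (hsum.trans hcard.symm))
    (hcard.symm ▸ htN)
  rw [← hpre, hbij.ncard_eq, hcount, hsum, hcard]
  push_cast
  ring

end TPartitions

section Types

/-- The block sizes, with multiplicity, of a partition with `ν i` blocks of size `m * i` for
`1 ≤ i ≤ n`. -/
def blockSizes (m n : ℕ) (ν : ℕ → ℕ) : Multiset ℕ :=
  ∑ i ∈ Finset.Icc 1 n, Multiset.replicate (ν i) (m * i)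

theorem card_blockSizes (m n : ℕ) (ν : ℕ → ℕ) :
    (blockSizes m n ν).card = ∑ i ∈ Finset.Icc 1 n, ν i := by
  simp [blockSizes]

theorem sum_blockSizes (m n : ℕ) (ν : ℕ → ℕ) :
    (blockSizes m n ν).sum = m * ∑ i ∈ Finset.Icc 1 n, i * ν i := by
  rw [blockSizes, Multiset.sum_sum, Finset.mul_sum]
  refine Finset.sum_congr rfl fun i _ => ?_
  rw [Multiset.sum_replicate, smul_eq_mul]
  ring

theorem exists_eq_mul_of_mem_blockSizes {m n k : ℕ} {ν : ℕ → ℕ} (hk : k ∈ blockSizes m n ν) :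
    ∃ i ∈ Finset.Icc 1 n, k = m * i := by
  obtain ⟨i, hi, hki⟩ := Multiset.mem_sum.1 hk
  exact ⟨i, hi, Multiset.eq_of_mem_replicate hki⟩

variable {m n t : ℕ} {ν : ℕ → ℕ}

theorem zero_notMem_blockSizes (hm : 0 < m) : 0 ∉ blockSizes m n ν := by
  intro h
  obtain ⟨i, hi, h0⟩ := exists_eq_mul_of_mem_blockSizes h
  exact (Nat.mul_pos hm (Finset.mem_Icc.1 hi).1).ne h0

theorem count_blockSizes (hm : 0 < m) {i : ℕ} (hi : i ∈ Finset.Icc 1 n) :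
    (blockSizes m n ν).count (m * i) = ν i := by
  rw [blockSizes, Multiset.count_sum', Finset.sum_eq_single_of_mem i hi,
    Multiset.count_replicate_self]
  intro j _ hj
  rw [Multiset.count_replicate, if_neg]
  exact fun h => hj (Nat.eq_of_mul_eq_mul_left hm h)

theorem countPerms_blockSizes (hm : 0 < m) :
    (blockSizes m n ν).countPerms = Nat.multinomial (Finset.Icc 1 n) ν := by
  have hinj : Set.InjOn (m * ·) (Finset.Icc 1 n : Set ℕ) :=
    fun i _ j _ h => Nat.eq_of_mul_eq_mul_left hm h
  have hcount (i : ℕ) (hi : i ∈ Finset.Icc 1 n) :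
      Multiset.toFinsupp (blockSizes m n ν) (m * i) = ν i := count_blockSizes hm hi
  rw [Multiset.countPerms, Finsupp.multinomial_eq_of_support_subset
    (s := (Finset.Icc 1 n).image (m * ·)), Nat.multinomial, Nat.multinomial,
    Finset.sum_image hinj, Finset.prod_image hinj, Finset.sum_congr rfl hcount,
    Finset.prod_congr rfl fun i hi => congrArg _ (hcount i hi)]
  intro k hk
  rw [Multiset.toFinsupp_support, Multiset.mem_toFinset] at hk
  obtain ⟨i, hi, rfl⟩ := exists_eq_mul_of_mem_blockSizes hk
  exact Finset.mem_image_of_mem _ hi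

theorem count_blockCards {N : ℕ} (π : Finpartition (Finset.Icc 1 N)) (k : ℕ) :
    (blockCards π).count k = blocksOfSize π k := by
  rw [blockCards, Multiset.count_map, blocksOfSize, Finset.card_def, Finset.filter_val]
  simp only [eq_comm]

theorem IsDivisible.exists_card_eq {π : Finpartition (Finset.Icc 1 (m * n))} (hm : 0 < m)
    (h : IsDivisible m π) {B : Finset ℕ} (hB : B ∈ π.parts) :
    ∃ i ∈ Finset.Icc 1 n, B.card = m * i := by
  obtain ⟨i, hi⟩ := h B hB
  have hpos : 0 < B.card := Finset.card_pos.2 (π.nonempty_of_mem_parts hB)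
  have hle : B.card ≤ m * n := by simpa using Finset.card_le_card (π.subset hB)
  rw [hi] at hpos hle
  exact ⟨i, Finset.mem_Icc.2 ⟨Nat.pos_of_mul_pos_left hpos, Nat.le_of_mul_le_mul_left hle hm⟩, hi⟩

theorem blockCards_eq_blockSizes_iff (hm : 0 < m) {π : Finpartition (Finset.Icc 1 (m * n))} :
    blockCards π = blockSizes m n ν ↔
      IsDivisible m π ∧ ∀ i ∈ Finset.Icc 1 n, blocksOfSize π (m * i) = ν i := by
  constructor
  · refine fun h => ⟨fun B hB => ?_, fun i hi => ?_⟩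
    · have hcard : B.card ∈ blockSizes m n ν := h ▸ Multiset.mem_map_of_mem _ hB
      obtain ⟨i, -, hi⟩ := exists_eq_mul_of_mem_blockSizes hcard
      exact ⟨i, hi⟩
    · rw [← count_blockCards, h, count_blockSizes hm hi]
  · rintro ⟨hdiv, hν⟩
    ext k
    by_cases hk : ∃ i ∈ Finset.Icc 1 n, k = m * i
    · obtain ⟨i, hi, rfl⟩ := hk
      rw [count_blockCards, hν i hi, count_blockSizes hm hi]
    · rw [Multiset.count_eq_zero.2 fun h => hk (exists_eq_mul_of_mem_blockSizes h),
        Multiset.count_eq_zero]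
      intro h
      obtain ⟨B, hB, rfl⟩ := Multiset.mem_map.1 h
      exact hk (hdiv.exists_card_eq hm hB)

theorem IsDivisible.sum_mul_blocksOfSize {π : Finpartition (Finset.Icc 1 (m * n))} (hm : 0 < m)
    (h : IsDivisible m π) : ∑ i ∈ Finset.Icc 1 n, i * blocksOfSize π (m * i) = n := by
  have hsum := congrArg Multiset.sum ((blockCards_eq_blockSizes_iff hm).2 ⟨h, fun _ _ => rfl⟩)
  have hcards : (blockCards π).sum = m * n :=
    π.sum_card_parts.trans ((Nat.card_Icc 1 (m * n)).trans (Nat.add_sub_cancel _ _))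
  rw [sum_blockSizes, hcards] at hsum
  exact (Nat.eq_of_mul_eq_mul_left hm hsum).symm

theorem IsDivisible.card_parts {π : Finpartition (Finset.Icc 1 (m * n))} (hm : 0 < m)
    (h : IsDivisible m π) : π.parts.card = ∑ i ∈ Finset.Icc 1 n, blocksOfSize π (m * i) := by
  have hcard := congrArg Multiset.card ((blockCards_eq_blockSizes_iff hm).2 ⟨h, fun _ _ => rfl⟩)
  rwa [blockCards, Multiset.card_map, card_blockSizes] at hcard

theorem IsDivisible.card_parts_le {π : Finpartition (Finset.Icc 1 (m * n))} (hm : 0 < m)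
    (h : IsDivisible m π) : π.parts.card ≤ n := by
  rw [h.card_parts hm]
  exact (Finset.sum_le_sum fun i hi => Nat.le_mul_of_pos_left _ (Finset.mem_Icc.1 hi).1).trans_eq
    (h.sum_mul_blocksOfSize hm)

/-- The `m`-divisible non-crossing `t`-partitions with `ν i` blocks of size `m * i` for
`1 ≤ i ≤ n`. -/
abbrev NCOfType (m n t : ℕ) (ν : ℕ → ℕ) : Set (Finpartition (Finset.Icc 1 (m * n))) :=
  {π ∈ NC m n t | ∀ i ∈ Finset.Icc 1 n, blocksOfSize π (m * i) = ν i}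

theorem NCOfType_eq_setOf_blockCards (hm : 0 < m) :
    NCOfType m n t ν = {π : Finpartition (Finset.Icc 1 (m * n)) |
      IsTPartition t π ∧ IsNoncrossing t π ∧ blockCards π = blockSizes m n ν} := by
  ext π
  simp only [NCOfType, NC, Set.mem_ofPred_eq, blockCards_eq_blockSizes_iff hm]
  tauto

theorem NCOfType_eq_empty (hm : 0 < m) (hν : ∑ i ∈ Finset.Icc 1 n, i * ν i ≠ n) :
    NCOfType m n t ν = ∅ := by
  refine Set.eq_empty_of_forall_notMem fun π ⟨hπ, h⟩ => hν ?_
  rw [← Finset.sum_congr rfl fun i hi => congrArg (i * ·) (h i hi), hπ.1.sum_mul_blocksOfSize hm]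

theorem binom_natCast_sub {b : ℕ} (N : ℕ) (h : t ≤ b) :
    binom N ((b : ℤ) - t) = N.choose (b - t) := by
  rw [← Nat.cast_sub h, binom, if_pos (Int.natCast_nonneg _), Int.toNat_natCast]

theorem binom_natCast_sub_of_lt {b : ℕ} (N : ℕ) (h : b < t) : binom N ((b : ℤ) - t) = 0 :=
  if_neg (by omega)

theorem binom_mul_succ_eq (N : ℕ) (k : ℤ) :
    (binom N k * (N + 1) : ℚ) = binom (N + 1) k * (N + 1 - k) := by
  rcases lt_or_ge k 0 with hk | hk
  · simp only [binom, if_neg hk.not_ge, Nat.cast_zero, zero_mul]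
  · lift k to ℕ using hk
    simp only [binom, if_pos (Int.natCast_nonneg k), Int.toNat_natCast, Int.cast_natCast]
    rcases le_or_gt k (N + 1) with hkN | hkN
    · have h := Nat.choose_mul_succ_eq N k
      rw [← @Nat.cast_inj ℚ] at h
      push_cast [Nat.cast_sub hkN] at h
      exact h
    · rw [Nat.choose_eq_zero_of_lt hkN, Nat.choose_eq_zero_of_lt (Nat.lt_of_succ_lt hkN)]
      simp only [Nat.cast_zero, zero_mul]

theorem choose_sub_sub_eq_binom {N b : ℕ} (htN : t ≤ N) (hbN : b ≤ N) :
    (N - t).choose (N - b) = binom (N - t) ((b : ℤ) - t) := by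
  rcases lt_or_ge b t with hbt | hbt
  · rw [binom_natCast_sub_of_lt _ hbt, Nat.choose_eq_zero_of_lt (by omega)]
  · rw [binom_natCast_sub _ hbt, Nat.choose_symm_of_eq_add (b := b - t) (by omega)]

theorem ncard_NCOfType {b : ℕ} (hm : 0 < m) (hn : 0 < n) (htmn : t ≤ m * n)
    (hb : ∑ i ∈ Finset.Icc 1 n, ν i = b) (hν : ∑ i ∈ Finset.Icc 1 n, i * ν i = n) :
    ((NCOfType m n t ν).ncard : ℚ) =
      (((m : ℚ) * n - t + 1) * b - (m : ℚ) * n * (b - (t : ℚ))) / (((m : ℚ) * n - t + 1) * b) *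
        binom (m * n - t + 1) ((b : ℤ) - t) * Nat.multinomial (Finset.Icc 1 n) ν := by
  have hC := zero_notMem_blockSizes (n := n) (ν := ν) hm
  have hcard : (blockSizes m n ν).card = b := (card_blockSizes m n ν).trans hb
  have hsum : (blockSizes m n ν).sum = m * n := by rw [sum_blockSizes, hν]
  have hbmn : b ≤ m * n := by
    rw [← hcard, ← hsum]
    exact card_le_sum_of_zero_notMem hC
  have hb0 : (b : ℚ) ≠ 0 := by
    rw [Nat.cast_ne_zero, ← hcard, Multiset.card_eq_zero.ne]
    intro h
    rw [h, Multiset.sum_zero] at hsum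
    exact (Nat.mul_pos hm hn).ne hsum
  have hcount := ncard_blockCards_eq_mul htmn hC hsum
  rw [← NCOfType_eq_setOf_blockCards hm, hcard, countPerms_blockSizes hm,
    choose_sub_sub_eq_binom htmn hbmn] at hcount
  have hbinom := binom_mul_succ_eq (m * n - t) ((b : ℤ) - t)
  push_cast [Nat.cast_sub htmn, Nat.cast_sub hbmn] at hcount hbinom
  have htq : (t : ℚ) ≤ m * n := by exact_mod_cast htmn
  have hbq : (b : ℚ) ≤ m * n := by exact_mod_cast hbmn
  have hM : (m : ℚ) * n - t + 1 ≠ 0 := by linarith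
  have hz : (m : ℚ) * n - b + 1 ≠ 0 := by linarith
  refine mul_right_cancel₀ hz (hcount.trans ?_)
  rw [eq_div_of_mul_eq hM hbinom]
  field_simp
  ring

end Types

section Totals

open PowerSeries in
theorem coeff_sum_X_pow_pow (n b : ℕ) :
    coeff (n + 1) ((∑ i ∈ Finset.Icc 1 (n + 1), X ^ i : ℤ⟦X⟧) ^ (b + 1)) = n.choose b := by
  have hdvd : (X : ℤ⟦X⟧) ^ (n + 2) ∣
      (X * mk 1) ^ (b + 1) - (∑ i ∈ Finset.Icc 1 (n + 1), X ^ i) ^ (b + 1) := by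
    refine dvd_trans ?_ (sub_dvd_pow_sub_pow _ _ _)
    refine X_pow_dvd_iff.2 fun d hd => ?_
    rw [map_sub, map_sum, sub_eq_zero]
    simp only [coeff_X_pow, Finset.sum_ite_eq, Finset.mem_Icc]
    cases d with
    | zero => simp
    | succ d =>
      rw [coeff_succ_X_mul, coeff_mk, if_pos (by omega), Pi.one_apply]
  have hcoeff := X_pow_dvd_iff.1 hdvd (n + 1) (Nat.lt_succ_self _)
  rw [map_sub, sub_eq_zero] at hcoeff
  rw [← hcoeff, mul_pow, mk_one_pow_eq_mk_choose_add, coeff_X_pow_mul', coeff_mk]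
  split_ifs with hbn
  · rw [Nat.add_sub_add_right, Nat.add_sub_cancel' (Nat.le_of_succ_le_succ hbn)]
  · rw [Nat.choose_eq_zero_of_lt (by omega), Nat.cast_zero]

/-- The multiplicity functions `ν` supported in `{1, …, n}` of the integer partitions of `n` into
`b` parts: these are the types of the `m`-divisible partitions of `{1, …, m * n}` into `b`
blocks. -/
def blockTypes (n b : ℕ) : Finset (ℕ → ℕ) :=
  {ν ∈ Finset.piAntidiag (Finset.Icc 1 n) b | ∑ i ∈ Finset.Icc 1 n, i * ν i = n}

theorem mem_blockTypes {n b : ℕ} {ν : ℕ → ℕ} :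
    ν ∈ blockTypes n b ↔ (∑ i ∈ Finset.Icc 1 n, ν i = b ∧ ∀ i, ν i ≠ 0 → i ∈ Finset.Icc 1 n) ∧
      ∑ i ∈ Finset.Icc 1 n, i * ν i = n := by
  rw [blockTypes, Finset.mem_filter, Finset.mem_piAntidiag]

open PowerSeries in
theorem sum_multinomial_blockTypes (n b : ℕ) :
    (∑ ν ∈ blockTypes n b, Nat.multinomial (Finset.Icc 1 n) ν : ℤ) =
      coeff n ((∑ i ∈ Finset.Icc 1 n, X ^ i : ℤ⟦X⟧) ^ b) := by
  rw [Finset.sum_pow_eq_sum_piAntidiag, map_sum, blockTypes, Finset.sum_filter]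
  refine Finset.sum_congr rfl fun ν _ => ?_
  simp only [← pow_mul, Finset.prod_pow_eq_pow_sum]
  rw [← map_natCast (C (R := ℤ)), coeff_C_mul, coeff_X_pow]
  simp [eq_comm]

theorem mul_sum_multinomial_blockTypes {n : ℕ} (hn : 0 < n) (b : ℕ) :
    n * ∑ ν ∈ blockTypes n b, Nat.multinomial (Finset.Icc 1 n) ν = b * n.choose b := by
  obtain ⟨n, rfl⟩ := Nat.exists_eq_add_of_le' hn
  have hsum := sum_multinomial_blockTypes (n + 1) b
  cases b with
  | zero =>
    rw [pow_zero, PowerSeries.coeff_one, if_neg n.succ_ne_zero] at hsum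
    rw [zero_mul, mul_eq_zero]
    exact_mod_cast Or.inr hsum
  | succ b =>
    rw [coeff_sum_X_pow_pow, ← Nat.cast_sum, Nat.cast_inj] at hsum
    rw [hsum, Nat.add_one_mul_choose_eq, mul_comm]

theorem ncard_eq_sum_ncard_fiber {α β : Type*} {A : Set α} (hA : A.Finite) {T : Finset β}
    {g : α → β} (hg : Set.MapsTo g A T) : A.ncard = ∑ b ∈ T, {a ∈ A | g a = b}.ncard := by
  classical
  lift A to Finset α using hA
  simp only [Finset.mem_coe, ← Finset.coe_filter, Set.ncard_coe_finset]
  exact Finset.card_eq_sum_card_fiberwise hg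

variable {m n t : ℕ}

theorem ncard_card_parts_eq_sum (hm : 0 < m) (b : ℕ) :
    {π ∈ NC m n t | π.parts.card = b}.ncard = ∑ ν ∈ blockTypes n b, (NCOfType m n t ν).ncard := by
  let type (π : Finpartition (Finset.Icc 1 (m * n))) (i : ℕ) : ℕ :=
    if i ∈ Finset.Icc 1 n then blocksOfSize π (m * i) else 0
  have htype {π : Finpartition (Finset.Icc 1 (m * n))} {i : ℕ} (hi : i ∈ Finset.Icc 1 n) :
      type π i = blocksOfSize π (m * i) := if_pos hi
  rw [ncard_eq_sum_ncard_fiber (Set.toFinite _) (g := type) (T := blockTypes n b)]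
  · refine Finset.sum_congr rfl fun ν hν => congrArg _ ?_
    obtain ⟨⟨hb, hsupp⟩, -⟩ := mem_blockTypes.1 hν
    ext π
    constructor
    · rintro ⟨⟨hπ, -⟩, rfl⟩
      exact ⟨hπ, fun i hi => (htype hi).symm⟩
    · rintro ⟨hπ, h⟩
      refine ⟨⟨hπ, ?_⟩, funext fun i => ?_⟩
      · rw [hπ.1.card_parts hm, Finset.sum_congr rfl h, hb]
      · by_cases hi : i ∈ Finset.Icc 1 n
        · rw [htype hi, h i hi]
        · exact (if_neg hi).trans (not_not.1 (mt (hsupp i) hi)).symm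
  · rintro π ⟨hπ, hb⟩
    refine mem_blockTypes.2 ⟨⟨?_, fun i hi => (ite_ne_right_iff.1 hi).1⟩, ?_⟩
    · rw [Finset.sum_congr rfl fun i hi => htype hi, ← hπ.1.card_parts hm, hb]
    · rw [Finset.sum_congr rfl fun i hi => congrArg (i * ·) (htype hi),
        hπ.1.sum_mul_blocksOfSize hm]

theorem ncard_card_parts (hm : 0 < m) (hn : 0 < n) (htmn : t ≤ m * n) (b : ℕ) :
    ({π ∈ NC m n t | π.parts.card = b}.ncard : ℚ) =
      ((m : ℚ) * n * t - b * ((t : ℚ) - 1)) / (n * ((m : ℚ) * n - t + 1)) *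
        binom (m * n - t + 1) ((b : ℤ) - t) * n.choose b := by
  have htype (ν : ℕ → ℕ) (hν : ν ∈ blockTypes n b) :=
    ncard_NCOfType hm hn htmn (mem_blockTypes.1 hν).1.1 (mem_blockTypes.1 hν).2
  have hsum : (n : ℚ) * ∑ ν ∈ blockTypes n b, (Nat.multinomial (Finset.Icc 1 n) ν : ℚ) =
      b * n.choose b := by exact_mod_cast mul_sum_multinomial_blockTypes hn b
  have hn0 : (n : ℚ) ≠ 0 := by positivity
  have hM : (m : ℚ) * n - t + 1 ≠ 0 := by
    have htq : (t : ℚ) ≤ m * n := by exact_mod_cast htmn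
    linarith
  rw [ncard_card_parts_eq_sum hm b, Nat.cast_sum, Finset.sum_congr rfl htype, ← Finset.mul_sum,
    eq_div_of_mul_eq hn0 ((mul_comm _ _).trans hsum)]
  rcases eq_or_ne b 0 with rfl | hb
  · rcases t.eq_zero_or_pos with rfl | ht
    · simp
    · rw [binom_natCast_sub_of_lt _ ht]
      simp
  · have hb0 : (b : ℚ) ≠ 0 := by exact_mod_cast hb
    field_simp
    ring

theorem ncard_rk_eq (hm : 0 < m) (hn : 0 < n) (htmn : t ≤ m * n) (s : ℕ) :
    ({π ∈ NC m n t | rk π = (s : ℤ)}.ncard : ℚ) =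
      ((m : ℚ) * n * t - ((n : ℚ) - s) * ((t : ℚ) - 1)) / ((n : ℚ) * ((m : ℚ) * n - t + 1)) *
        binom (m * n - t + 1) ((n : ℤ) - s - t) * n.choose s := by
  rcases le_or_gt s n with hs | hs
  · have hrk (π : Finpartition (Finset.Icc 1 (m * n))) : rk π = s ↔ π.parts.card = n - s := by
      rw [rk]
      omega
    simp only [hrk]
    rw [ncard_card_parts hm hn htmn, Nat.choose_symm hs, Nat.cast_sub hs, Nat.cast_sub hs]
  · have hempty : {π ∈ NC m n t | rk π = (s : ℤ)} = ∅ := by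
      refine Set.eq_empty_of_forall_notMem fun π ⟨_, h⟩ => ?_
      rw [rk] at h
      omega
    rw [hempty, Set.ncard_empty, Nat.choose_eq_zero_of_lt hs, Nat.cast_zero, mul_zero]

theorem sum_binom_mul_choose (M k n t : ℕ) :
    ∑ b ∈ Finset.range (n + 1), binom M ((b : ℤ) - t) * k.choose (n - b) =
      binom (M + k) ((n : ℤ) - t) := by
  rcases lt_or_ge n t with hnt | htn
  · rw [binom_natCast_sub_of_lt _ hnt]
    refine Finset.sum_eq_zero fun b hb => ?_
    rw [binom_natCast_sub_of_lt _ ((Nat.lt_succ_iff.1 (Finset.mem_range.1 hb)).trans_lt hnt),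
      zero_mul]
  · obtain ⟨d, rfl⟩ := Nat.exists_eq_add_of_le htn
    rw [binom_natCast_sub _ htn, Nat.add_sub_cancel_left, Nat.add_choose_eq,
      Finset.Nat.sum_antidiagonal_eq_sum_range_succ (fun i j => M.choose i * k.choose j),
      Nat.add_assoc, Finset.sum_range_add, Finset.sum_eq_zero, zero_add]
    · refine Finset.sum_congr rfl fun i _ => ?_
      rw [binom_natCast_sub _ (Nat.le_add_right t i), Nat.add_sub_cancel_left,
        Nat.add_sub_add_left]
    · intro b hb
      rw [binom_natCast_sub_of_lt _ (Finset.mem_range.1 hb), zero_mul]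

theorem mul_choose_eq_mul_choose_sub {b : ℕ} (hn : 0 < n) (hb : b ≤ n) :
    b * n.choose b = n * (n - 1).choose (n - b) := by
  obtain ⟨n, rfl⟩ : ∃ k, n = k + 1 := Nat.exists_eq_add_of_le' hn
  cases b with
  | zero => simp
  | succ b =>
    rw [mul_comm, ← Nat.add_one_mul_choose_eq, Nat.add_sub_cancel, Nat.add_sub_add_right,
      Nat.choose_symm (Nat.le_of_succ_le_succ hb)]

theorem ncard_NC_eq_sum (hm : 0 < m) :
    (NC m n t).ncard = ∑ b ∈ Finset.range (n + 1), {π ∈ NC m n t | π.parts.card = b}.ncard :=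
  ncard_eq_sum_ncard_fiber (Set.toFinite _) fun _ hπ =>
    Finset.mem_coe.2 (Finset.mem_range_succ_iff.2 (hπ.1.card_parts_le hm))

theorem ncard_NC (hm : 0 < m) (hn : 0 < n) (htmn : t ≤ m * n) :
    ((NC m n t).ncard : ℚ) =
      ((m : ℚ) * t + 1) / ((m : ℚ) * n + 1) * binom ((m + 1) * n - t) ((n : ℤ) - t) := by
  have hM : (m : ℚ) * n - t + 1 ≠ 0 := by
    have htq : (t : ℚ) ≤ m * n := by exact_mod_cast htmn
    linarith
  have hn0 : (n : ℚ) ≠ 0 := by positivity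
  have hmn : (m : ℚ) * n + 1 ≠ 0 := by positivity
  obtain ⟨K, hK⟩ : ∃ K, (m + 1) * n - t = K := ⟨_, rfl⟩
  have hKt : K + t = m * n + n := by rw [← hK, add_one_mul, Nat.sub_add_cancel (by omega)]
  have hterm (b : ℕ) (hb : b ∈ Finset.range (n + 1)) :
      ({π ∈ NC m n t | π.parts.card = b}.ncard : ℚ) =
        (m * t * (binom (m * n - t + 1) ((b : ℤ) - t) * n.choose (n - b) : ℕ) -
          (t - 1) * (binom (m * n - t + 1) ((b : ℤ) - t) * (n - 1).choose (n - b) : ℕ)) /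
            (m * n - t + 1) := by
    have hbn := Finset.mem_range_succ_iff.1 hb
    have habsorb : (b * n.choose b : ℚ) = n * (n - 1).choose (n - b) := by
      exact_mod_cast mul_choose_eq_mul_choose_sub hn hbn
    rw [ncard_card_parts hm hn htmn, Nat.choose_symm hbn, Nat.cast_mul, Nat.cast_mul]
    field_simp
    linear_combination (1 - t) * binom (m * n - t + 1) ((b : ℤ) - t) * habsorb
  have hvandermonde := binom_mul_succ_eq K ((n : ℤ) - t)
  rw [ncard_NC_eq_sum hm, Nat.cast_sum, Finset.sum_congr rfl hterm, ← Finset.sum_div,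
    Finset.sum_sub_distrib, ← Finset.mul_sum, ← Finset.mul_sum, ← Nat.cast_sum, ← Nat.cast_sum,
    sum_binom_mul_choose, sum_binom_mul_choose, hK,
    show m * n - t + 1 + n = K + 1 by omega, show m * n - t + 1 + (n - 1) = K by omega]
  have hKq : (K : ℚ) = m * n + n - t := eq_sub_of_add_eq (by exact_mod_cast hKt)
  push_cast at hvandermonde
  rw [hKq] at hvandermonde
  field_simp
  linear_combination (-m * t) * hvandermonde

end Totals

end TNoncrossing

theorem theorem3p1 (m n t : ℕ) (hm : 0 < m) (hn : 0 < n) (ht : 0 < t) (htmn : t ≤ m * n) :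
    -- prescribed block sizes
    (∀ b : ℕ → ℕ,
      (∑ i ∈ Finset.Icc 1 n, i * b i = n →
        (Set.ncard {π ∈ TNoncrossing.NC m n t |
            ∀ i ∈ Finset.Icc 1 n, TNoncrossing.blocksOfSize π (m * i) = b i} : ℚ) =
          (((m : ℚ) * n - t + 1) * (∑ i ∈ Finset.Icc 1 n, b i : ℕ)
              - (m : ℚ) * n * ((∑ i ∈ Finset.Icc 1 n, b i : ℕ) - (t : ℚ))) /
            (((m : ℚ) * n - t + 1) * (∑ i ∈ Finset.Icc 1 n, b i : ℕ)) *
          TNoncrossing.binom (m * n - t + 1) (((∑ i ∈ Finset.Icc 1 n, b i : ℕ) : ℤ) - t) *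
          Nat.multinomial (Finset.Icc 1 n) b) ∧
      (∑ i ∈ Finset.Icc 1 n, i * b i ≠ n →
        Set.ncard {π ∈ TNoncrossing.NC m n t |
            ∀ i ∈ Finset.Icc 1 n, TNoncrossing.blocksOfSize π (m * i) = b i} = 0)) ∧
    -- prescribed rank
    (∀ s : ℕ,
      (Set.ncard {π ∈ TNoncrossing.NC m n t | TNoncrossing.rk π = (s : ℤ)} : ℚ) =
        ((m : ℚ) * n * t - ((n : ℚ) - s) * ((t : ℚ) - 1)) / ((n : ℚ) * ((m : ℚ) * n - t + 1)) *
        TNoncrossing.binom (m * n - t + 1) ((n : ℤ) - s - t) *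
        Nat.choose n s) ∧
    -- total number
    (Set.ncard (TNoncrossing.NC m n t) : ℚ) =
      ((m : ℚ) * t + 1) / ((m : ℚ) * n + 1) *
      TNoncrossing.binom ((m + 1) * n - t) ((n : ℤ) - t) := by
  refine ⟨fun b => ⟨TNoncrossing.ncard_NCOfType hm hn htmn rfl, fun hb => ?_⟩,
    TNoncrossing.ncard_rk_eq hm hn htmn, TNoncrossing.ncard_NC hm hn htmn⟩
  exact (congrArg Set.ncard (TNoncrossing.NCOfType_eq_empty hm hb)).trans (Set.ncard_empty _)
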